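/- Let $p$ be an odd prime and let $k,n\ge 1$ be integers. Write $M_d$ for the algebra of $d\times d$ complex matrices with the inner product $\langle A,B\rangle=\mathrm{Tr}(A^*B)$. Two unital $*$-subalgebras $\mathcal A_1,\mathcal A_2\subseteq M_d$ are called quasi-orthogonal if $\mathcal A_1\ominus\mathbb C I\perp\mathcal A_2\ominus\mathbb C I$, where $\mathcal A_i\ominus\mathbb C I$ is the set of all elements of $\mathcal A_i$ that are orthogonal to $I$. Put $$N_{(k,n)}=\frac{p^{2kn}-1}{p^{2k}-1}.$$ Then $M_{p^{kn}}$ contains $N_{(k,n)}$ pairwise quasi-orthogonal unital $*$-subalgebras each of which is $*$-isomorphic to $M_{p^k}$, and this number is maximal: whenever $\mathcal A_1,\dots,\mathcal A_l$ are pairwise quasi-orthogonal unital $*$-subalgebras of $M_{p^{kn}}$ each $*$-isomorphic to $M_{p^k}$, one has $l\le N_{(k,n)}$. -/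

import Mathlib

open scoped Matrix

/-- The Hilbert-Schmidt inner product `⟨X, Y⟩ = Tr(X* Y)` on the algebra of `d × d` complex
matrices. -/
def hsInner {d : ℕ} (X Y : Matrix (Fin d) (Fin d) ℂ) : ℂ :=
  (Xᴴ * Y).trace

/-- `A ⊖ ℂI`: the elements of the unital *-subalgebra `A` which are orthogonal to the scalar
multiples of the identity. -/
def ominusScalars {d : ℕ} (A : StarSubalgebra ℂ (Matrix (Fin d) (Fin d) ℂ)) :
    Set (Matrix (Fin d) (Fin d) ℂ) :=
  {X | X ∈ A ∧ ∀ c : ℂ, hsInner (c • 1) X = 0}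

/-- Two unital *-subalgebras `A`, `B` are quasi-orthogonal if `A ⊖ ℂI ⊥ B ⊖ ℂI`. -/
def QuasiOrthogonal {d : ℕ} (A B : StarSubalgebra ℂ (Matrix (Fin d) (Fin d) ℂ)) : Prop :=
  ∀ X ∈ ominusScalars A, ∀ Y ∈ ominusScalars B, hsInner X Y = 0

/-- `M_d` contains `l` pairwise quasi-orthogonal unital *-subalgebras each of which is
*-isomorphic to `M_m`. -/
def ContainsQuasiOrthogonal (d m l : ℕ) : Prop :=
  ∃ A : Fin l → StarSubalgebra ℂ (Matrix (Fin d) (Fin d) ℂ),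
    (∀ i, Nonempty (A i ≃⋆ₐ[ℂ] Matrix (Fin m) (Fin m) ℂ)) ∧
    ∀ i j, i ≠ j → QuasiOrthogonal (A i) (A j)

/-- The number `(p^{2kn} - 1) / (p^{2k} - 1)`; the division is exact, see
`quasiOrthNumber_mul`. -/
def quasiOrthNumber (p k n : ℕ) : ℕ :=
  (p ^ (2 * k * n) - 1) / (p ^ (2 * k) - 1)

theorem quasiOrthNumber_mul (p k n : ℕ) :
    quasiOrthNumber p k n * (p ^ (2 * k) - 1) = p ^ (2 * k * n) - 1 := by
  unfold quasiOrthNumber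
  apply Nat.div_mul_cancel
  rw [pow_mul p (2 * k) n]
  exact Nat.sub_one_dvd_pow_sub_one _ _

/-! The upper bound counts dimensions: the traceless parts of the subalgebras are mutually
orthogonal inside the traceless matrices (`ContainsQuasiOrthogonal.mul_le`). For existence, let `F`
have `q = p^k` elements. The Weyl operators of the symplectic space `(F²)ⁿ` form an orthogonal basis
of the matrices of size `q^n`, and those of a nondegenerate plane span a copy of `M_q`. Planes
meeting only in `0` give quasi-orthogonal copies, so it suffices to find `1 + q² + ... + q^(2(n-1))`
such planes (`exists_hyperbolic_planes`). They come by induction on `n`: to the planes inside the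
last `n` coordinates add graphs of maps `F² → (F²)ⁿ`. A map scaling the form by `c` has a
nondegenerate graph iff `1 + c ≠ 0`, and graphs meet trivially when the maps agree only at `0`
(`exists_sum_maps`). -/

/-! ### Upper bound by dimension -/

theorem hsInner_sum_right {d : ℕ} {ι : Type*} (s : Finset ι) (X : Matrix (Fin d) (Fin d) ℂ)
    (Y : ι → Matrix (Fin d) (Fin d) ℂ) :
    hsInner X (∑ i ∈ s, Y i) = ∑ i ∈ s, hsInner X (Y i) := by
  simp [hsInner, Finset.mul_sum, Matrix.trace_sum]

theorem hsInner_smul_one {d : ℕ} (c : ℂ) (X : Matrix (Fin d) (Fin d) ℂ) :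
    hsInner (c • 1) X = star c * X.trace := by
  simp [hsInner]

/-- The number of pairwise quasi-orthogonal copies of `M_m` in `M_d` is bounded by comparing
dimensions of the spaces of traceless elements. -/
theorem ContainsQuasiOrthogonal.mul_le {d m l : ℕ} (hd : d ≠ 0)
    (h : ContainsQuasiOrthogonal d m l) : l * (m ^ 2 - 1) ≤ d ^ 2 - 1 := by
  obtain ⟨A, hA, hq⟩ := h
  have : NeZero d := ⟨hd⟩
  let τ : Matrix (Fin d) (Fin d) ℂ →ₗ[ℂ] ℂ := Matrix.traceLinearMap (Fin d) ℂ ℂ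
  have hτ1 : τ 1 ≠ 0 := by simp [τ, hd]
  let B : Fin l → Submodule ℂ (Matrix (Fin d) (Fin d) ℂ) := fun i =>
    Subalgebra.toSubmodule (A i).toSubalgebra
  let τA : ∀ i, B i →ₗ[ℂ] ℂ := fun i => τ.domRestrict (B i)
  have hker : Module.finrank ℂ (LinearMap.ker τ) + 1 = d ^ 2 := by
    rw [Module.Dual.finrank_ker_add_one_of_ne_zero (f := τ) (fun h0 => hτ1 (by simp [h0])),
      Module.finrank_matrix]
    simp [sq]
  have hkerA : ∀ i, Module.finrank ℂ (LinearMap.ker (τA i)) + 1 = m ^ 2 := by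
    intro i
    obtain ⟨e⟩ := hA i
    rw [Module.Dual.finrank_ker_add_one_of_ne_zero (f := τA i)
      (fun h0 => hτ1 (congrArg (fun f => f ⟨1, (A i).one_mem⟩) h0)),
      LinearEquiv.finrank_eq (show B i ≃ₗ[ℂ] _ from e.toAlgEquiv.toLinearEquiv), Module.finrank_matrix]
    simp [sq]
  let K : Fin l → Submodule ℂ (Matrix (Fin d) (Fin d) ℂ) := fun i =>
    (LinearMap.ker (τA i)).map (B i).subtype
  have hK : ∀ i, Module.finrank ℂ (K i) = m ^ 2 - 1 := fun i => by
    rw [Submodule.finrank_map_subtype_eq, ← hkerA i, Nat.add_sub_cancel]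
  have htrace : ∀ i (x : K i), (x : Matrix (Fin d) (Fin d) ℂ).trace = 0 := by
    rintro i ⟨_, y, hy, rfl⟩
    exact hy
  have hmem : ∀ i (x : K i), (x : Matrix (Fin d) (Fin d) ℂ) ∈ ominusScalars (A i) := by
    intro i x
    refine ⟨?_, fun c => by rw [hsInner_smul_one, htrace, mul_zero]⟩
    obtain ⟨_, y, hy, rfl⟩ := x
    exact y.2
  let f : (∀ i, K i) →ₗ[ℂ] Matrix (Fin d) (Fin d) ℂ :=
    ∑ i, (K i).subtype ∘ₗ LinearMap.proj i
  have hf : ∀ x, f x = ∑ i, (x i : Matrix (Fin d) (Fin d) ℂ) := by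
    intro x
    simp [f]
  have hfker : ∀ x, f x ∈ LinearMap.ker τ := by
    intro x
    rw [hf]
    exact Submodule.sum_mem _ fun i _ => htrace i (x i)
  have hinj : Function.Injective (f.codRestrict _ hfker) := by
    rw [injective_iff_map_eq_zero]
    intro x hx
    have hx0 : ∑ i, (x i : Matrix (Fin d) (Fin d) ℂ) = 0 := by
      rw [← hf]
      exact congrArg Subtype.val hx
    ext1 j
    -- Pairing the vanishing sum with its `j`-th term leaves only the squared norm of that term.
    have h1 := hsInner_sum_right Finset.univ (x j : Matrix (Fin d) (Fin d) ℂ)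
      (fun i => (x i : Matrix (Fin d) (Fin d) ℂ))
    rw [hx0, Finset.sum_eq_single j (fun i _ hij => hq j i hij.symm _ (hmem _ _) _ (hmem _ _))
      (by simp)] at h1
    open scoped ComplexOrder in
    exact Subtype.ext
      (Matrix.trace_conjTranspose_mul_self_eq_zero_iff.1 (by simpa [hsInner] using h1.symm))
  have hle := LinearMap.finrank_le_finrank_of_injective hinj
  rw [Module.finrank_pi_fintype] at hle
  simp only [hK, Finset.sum_const, Finset.card_univ, Fintype.card_fin, smul_eq_mul] at hle
  omega

/-! ### Hyperbolic planes meeting trivially -/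

section HyperbolicPlanes

universe u

variable {F : Type u} [Field F]

/-- The standard alternating form on the plane. -/
def planeForm (x y : F × F) : F := x.1 * y.2 - x.2 * y.1

/-- The norm form `a² - d b²` of `F[√d]`. -/
def planeNorm (d : F) (m : F × F) : F := m.1 ^ 2 - d * m.2 ^ 2

/-- Multiplication by `m` in `F[√d]`. -/
def planeMul (d : F) (m : F × F) : F × F →+ F × F where
  toFun x := (m.1 * x.1 + d * m.2 * x.2, m.1 * x.2 + m.2 * x.1)
  map_zero' := by simp
  map_add' x y := by ext <;> simp <;> ring

/-- Conjugation of `F[√d]`. -/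
def planeConj : F × F →+ F × F where
  toFun x := (x.1, -x.2)
  map_zero' := by simp
  map_add' x y := by ext <;> simp; ring

theorem exists_planeForm_ne_zero {x : F × F} (hx : x ≠ 0) : ∃ z, planeForm x z ≠ 0 := by
  by_contra! h0
  refine hx (Prod.ext ?_ ?_)
  · simpa [planeForm] using h0 (0, 1)
  · simpa [planeForm] using h0 (1, 0)

theorem planeForm_mul (d : F) (m x y : F × F) :
    planeForm (planeMul d m x) (planeMul d m y) = planeNorm d m * planeForm x y := by
  simp only [planeForm, planeMul, planeNorm, AddMonoidHom.coe_mk, ZeroHom.coe_mk]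
  ring

theorem planeForm_conj (x y : F × F) :
    planeForm (planeConj x) (planeConj y) = -planeForm x y := by
  simp only [planeForm, planeConj, AddMonoidHom.coe_mk, ZeroHom.coe_mk]
  ring

theorem planeNorm_mul (d : F) (m x : F × F) :
    planeNorm d (planeMul d m x) = planeNorm d m * planeNorm d x := by
  simp only [planeMul, planeNorm, AddMonoidHom.coe_mk, ZeroHom.coe_mk]
  ring

theorem planeNorm_conj (d : F) (x : F × F) : planeNorm d (planeConj x) = planeNorm d x := by
  simp [planeConj, planeNorm]

theorem planeNorm_eq_zero {d : F} (hd : ¬IsSquare d) {x : F × F} :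
    planeNorm d x = 0 ↔ x = 0 := by
  refine ⟨fun h => ?_, fun h => by simp [h, planeNorm]⟩
  have h' : x.1 ^ 2 = d * x.2 ^ 2 := sub_eq_zero.1 h
  by_cases h2 : x.2 = 0
  · ext
    · simpa [h2] using h'
    · exact h2
  · refine absurd ⟨x.1 / x.2, ?_⟩ hd
    field_simp
    exact h'.symm

theorem planeMul_left_injective {d : F} (hd : ¬IsSquare d) {x : F × F} (hx : x ≠ 0)
    {m m' : F × F} (h : planeMul d m x = planeMul d m' x) : m = m' := by
  have h1 : planeMul d (m - m') x = 0 := by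
    have : planeMul d (m - m') x = planeMul d m x - planeMul d m' x := by
      ext <;> simp [planeMul] <;> ring
    rw [this, h, sub_self]
  have h2 := planeNorm_mul d (m - m') x
  rw [h1, (planeNorm_eq_zero hd).2 rfl, eq_comm, mul_eq_zero, planeNorm_eq_zero hd,
    planeNorm_eq_zero hd] at h2
  exact sub_eq_zero.1 (h2.resolve_right hx)

/-- For every nonzero `s` there is a family of linear maps of the plane, indexed by the plane,
which have pairwise invertible differences and whose determinants avoid `-s`. -/
theorem exists_plane_maps {d : F} (hd : ¬IsSquare d) (h2 : (2 : F) ≠ 0) {s : F} (hs : s ≠ 0) :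
    ∃ (g : F × F → F × F →+ F × F) (c : F × F → F),
      (∀ m x y, planeForm (g m x) (g m y) = c m * planeForm x y) ∧
      (∀ m, s + c m ≠ 0) ∧ ∀ m m' x, x ≠ 0 → g m x = g m' x → m = m' := by
  classical
  -- Multiplication by `m` has determinant `planeNorm d m`. When this is the forbidden `-s`,
  -- composing with conjugation flips it to `s`, and `s + s ≠ 0` in odd characteristic.
  refine ⟨fun m => if planeNorm d m = -s then (planeMul d m).comp planeConj else planeMul d m,
    fun m => if planeNorm d m = -s then s else planeNorm d m, ?_, ?_, ?_⟩
  · intro m x y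
    by_cases h : planeNorm d m = -s
    · simp [h, planeForm_mul, planeForm_conj]
    · simp [h, planeForm_mul]
  · intro m
    by_cases h : planeNorm d m = -s
    · simpa [h, ← two_mul] using ⟨h2, hs⟩
    · simpa [h] using fun h0 => h (eq_neg_of_add_eq_zero_right h0)
  · intro m m' x hx h
    -- Conjugation preserves the norm, so the norm of the image determines that of `m`; hence `m`
    -- and `m'` fall under the same branch.
    have hN : planeNorm d m = planeNorm d m' := by
      have h3 : ∀ m, planeNorm d ((if planeNorm d m = -s then (planeMul d m).comp planeConj
          else planeMul d m) x) = planeNorm d m * planeNorm d x := by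
        intro m
        split_ifs <;> simp [planeNorm_mul, planeNorm_conj]
      have h4 := congrArg (planeNorm d) h
      dsimp only at h4
      rw [h3, h3] at h4
      exact mul_right_cancel₀ (mt (planeNorm_eq_zero hd).1 hx) h4
    by_cases h5 : planeNorm d m' = -s
    · simp only [hN, h5, if_true, AddMonoidHom.comp_apply] at h
      refine planeMul_left_injective hd (fun h0 => hx ?_) h
      rwa [← planeNorm_eq_zero hd, planeNorm_conj, planeNorm_eq_zero hd] at h0
    · simp only [hN, h5, if_false] at h
      exact planeMul_left_injective hd hx h

/-- The orthogonal sum of planes. -/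
def sumForm {ι : Type*} [Fintype ι] (v w : ι → F × F) : F := ∑ i, planeForm (v i) (w i)

/-- Prepending a coordinate, as an additive homomorphism. -/
def consHom {M : Type*} [AddCommGroup M] {V : Type*} [AddCommGroup V] {n : ℕ} (f : V →+ M)
    (g : V →+ (Fin n → M)) : V →+ (Fin (n + 1) → M) where
  toFun x := Fin.cons (f x) (g x)
  map_zero' := by
    ext i
    refine Fin.cases ?_ (fun j => ?_) i <;> simp
  map_add' x y := by
    ext i
    refine Fin.cases ?_ (fun j => ?_) i <;> simp

theorem consHom_eq_iff {M : Type*} [AddCommGroup M] {V : Type*} [AddCommGroup V] {n : ℕ}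
    (f f' : V →+ M) (g g' : V →+ (Fin n → M)) (x y : V) :
    consHom f g x = consHom f' g' y ↔ f x = f' y ∧ g x = g' y :=
  Fin.cons_inj (α := fun _ => M)

theorem sumForm_consHom {V : Type*} [AddCommGroup V] {n : ℕ} (f : V →+ F × F)
    (g : V →+ (Fin n → F × F)) (x y : V) :
    sumForm (consHom f g x) (consHom f g y) =
      planeForm (f x) (f y) + sumForm (g x) (g y) := by
  simp [sumForm, consHom, Fin.sum_univ_succ]

/-- The maps are built one coordinate at a time. Here `s` is the running total of the scaling
factors: each new coordinate must keep it nonzero, so its map may depend on the earlier coordinates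
of `m`. -/
theorem exists_sum_maps {d : F} (hd : ¬IsSquare d) (h2 : (2 : F) ≠ 0) (n : ℕ) :
    ∀ s : F, s ≠ 0 →
    ∃ (g : (Fin n → F × F) → F × F →+ (Fin n → F × F)) (c : (Fin n → F × F) → F),
      (∀ m x y, sumForm (g m x) (g m y) = c m * planeForm x y) ∧
      (∀ m, s + c m ≠ 0) ∧ ∀ m m' x, x ≠ 0 → g m x = g m' x → m = m' := by
  induction n with
  | zero =>
    intro s hs
    exact ⟨fun _ => 0, fun _ => 0, by simp [sumForm], by simpa using hs,
      fun _ _ _ _ _ => Subsingleton.elim _ _⟩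
  | succ n ih =>
    intro s hs
    obtain ⟨g, c, hg, hc, hinj⟩ := exists_plane_maps hd h2 hs
    choose G C hG hC hGinj using fun m => ih (s + c m) (hc m)
    refine ⟨fun m => consHom (g (m 0)) (G (m 0) (Fin.tail m)),
      fun m => c (m 0) + C (m 0) (Fin.tail m), fun m x y => ?_, fun m => ?_,
      fun m m' x hx h => ?_⟩
    · rw [sumForm_consHom, hg, hG, add_mul]
    · rw [← add_assoc]
      exact hC _ _
    · rw [consHom_eq_iff] at h
      have h0 := hinj _ _ x hx h.1
      have h1 := h.2
      rw [h0] at h1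
      have h3 := hGinj _ _ _ x hx h1
      rw [← Fin.cons_self_tail m, ← Fin.cons_self_tail m', h0, h3]

/-- The space `(F²)ⁿ` contains `∑_{i<n} q^{2i}` hyperbolic planes that meet pairwise trivially. -/
theorem exists_hyperbolic_planes [Fintype F] {d : F} (hd : ¬IsSquare d) (h2 : (2 : F) ≠ 0)
    (n : ℕ) :
    ∃ h : Fin (∑ i ∈ Finset.range n, (Fintype.card F ^ 2) ^ i) → F × F →+ (Fin n → F × F),
      (∀ i x y, sumForm (h i x) (h i y) = planeForm x y) ∧
      ∀ i j x y, x ≠ 0 → h i x = h j y → i = j := by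
  -- Graphs scale the form by varying nonzero factors; rescaling one coordinate of the source by the
  -- inverse factor normalises them.
  suffices H : ∃ (I : Type u) (_ : Fintype I) (h : I → F × F →+ (Fin n → F × F)) (c : I → F),
      Fintype.card I = ∑ i ∈ Finset.range n, (Fintype.card F ^ 2) ^ i ∧
      (∀ i x y, sumForm (h i x) (h i y) = c i * planeForm x y) ∧ (∀ i, c i ≠ 0) ∧
      ∀ i j x y, x ≠ 0 → h i x = h j y → i = j by
    obtain ⟨I, _, h, c, hI, hform, hc, hdisj⟩ := H
    let e := (Fintype.equivFinOfCardEq hI).symm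
    let r : F → F × F →+ F × F := fun a => (AddMonoidHom.id F).prodMap (AddMonoidHom.mulLeft a)
    refine ⟨fun i => (h (e i)).comp (r (c (e i))⁻¹), fun i x y => ?_,
      fun i j x y hx hxy => e.injective (hdisj _ _ (r (c (e i))⁻¹ x) _ (fun h0 => hx ?_) hxy)⟩
    · have := hc (e i)
      simp only [AddMonoidHom.comp_apply, hform]
      simp [r, planeForm]
      field_simp
    · simpa [r, Prod.ext_iff, hc] using h0
  induction n with
  | zero => exact ⟨PEmpty, inferInstance, PEmpty.elim, PEmpty.elim, by simp, by simp, by simp,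
      by simp⟩
  | succ n ih =>
    obtain ⟨I, _, h, c, hI, hform, hc, hdisj⟩ := ih
    -- `s = 1` accounts for the identity component of the graph.
    obtain ⟨g, C, hg, hC, hinj⟩ := exists_sum_maps hd h2 n 1 one_ne_zero
    refine ⟨I ⊕ (Fin n → F × F), inferInstance,
      Sum.elim (fun i => consHom 0 (h i)) (fun m => consHom (AddMonoidHom.id _) (g m)),
      Sum.elim c (fun m => 1 + C m), ?_, ?_, ?_, ?_⟩
    · rw [Fintype.card_sum, hI, Finset.sum_range_succ]
      simp [sq]
    · rintro (i | m) x y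
      · simp only [Sum.elim_inl]
        rw [sumForm_consHom, hform]
        simp [planeForm]
      · simp only [Sum.elim_inr]
        rw [sumForm_consHom, hg]
        simp [add_mul]
    · rintro (i | m)
      · exact hc i
      · exact hC m
    · rintro (i | m) (j | m') x y hx hxy <;>
        simp only [Sum.elim_inl, Sum.elim_inr, consHom_eq_iff, AddMonoidHom.id_apply,
          AddMonoidHom.zero_apply] at hxy
      · exact congrArg _ (hdisj _ _ x y hx hxy.2)
      -- An old plane meets a graph only where the first coordinate vanishes, so `h i x = 0`, which
      -- nondegeneracy excludes.
      · rw [← hxy.1, map_zero] at hxy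
        exfalso
        have hz := hform i x
        obtain ⟨z, hz'⟩ := exists_planeForm_ne_zero hx
        specialize hz z
        rw [hxy.2, eq_comm] at hz
        simp [sumForm, planeForm] at hz
        exact hz.elim (hc i) hz'
      · exact absurd hxy.1 hx
      · rw [← hxy.1] at hxy
        exact congrArg _ (hinj _ _ x hx hxy.2)

end HyperbolicPlanes

/-! ### Weyl operators and the subalgebras they span -/

section WeylSystems

/-- A system of Weyl operators on an abelian group `G` with cocycle `c`. -/
structure IsWeylSystem {G N : Type*} [AddCommGroup G] [Fintype N] [DecidableEq N]
    (c : G → G → ℂ) (W : G → Matrix N N ℂ) : Prop where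
  map_zero : W 0 = 1
  mul : ∀ v w, W v * W w = c v w • W (v + w)
  cocycle_ne_zero : ∀ v w, c v w ≠ 0
  conjTranspose : ∀ v, (W v)ᴴ = W (-v)
  trace : ∀ v, v ≠ 0 → (W v).trace = 0

namespace IsWeylSystem

variable {G N : Type*} [AddCommGroup G] [Fintype N] [DecidableEq N] {c : G → G → ℂ}
  {W : G → Matrix N N ℂ}

theorem reindex (h : IsWeylSystem c W) {N' : Type*} [Fintype N'] [DecidableEq N'] (e : N ≃ N') :
    IsWeylSystem c (fun v => Matrix.reindex e e (W v)) where
  map_zero := by simp [h.map_zero]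
  mul v w := by
    simp only [Matrix.reindex_apply, Matrix.submatrix_mul_equiv, h.mul, Matrix.submatrix_smul,
      Pi.smul_apply]
  conjTranspose v := by simp [Matrix.conjTranspose_submatrix, h.conjTranspose]
  cocycle_ne_zero := h.cocycle_ne_zero
  trace v hv := by
    rw [← h.trace v hv]
    exact Equiv.sum_comp e.symm fun i => W v i i

theorem trace_conjTranspose_mul (h : IsWeylSystem c W) {v w : G} (hvw : v ≠ w) :
    ((W v)ᴴ * W w).trace = 0 := by
  rw [h.conjTranspose, h.mul, Matrix.trace_smul, h.trace _ (by rwa [neg_add_eq_sub, sub_ne_zero, ne_comm]),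
    smul_zero]

theorem conjTranspose_mul_ne_zero [Nonempty N] (h : IsWeylSystem c W) (v : G) :
    ((W v)ᴴ * W v).trace ≠ 0 := by
  simp [h.conjTranspose, h.mul, h.map_zero, h.cocycle_ne_zero]

theorem linearIndependent [Nonempty N] (h : IsWeylSystem c W) : LinearIndependent ℂ W := by
  rw [linearIndependent_iff']
  intro s a hs v hv
  have h1 : ((W v)ᴴ * ∑ w ∈ s, a w • W w).trace = 0 := by simp [hs]
  rw [Finset.mul_sum, Matrix.trace_sum, Finset.sum_eq_single v] at h1
  · simpa [h.conjTranspose_mul_ne_zero v] using h1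
  · intro w _ hw
    simp [h.trace_conjTranspose_mul hw.symm]
  · exact fun h0 => absurd hv h0

/-- The basis of a full matrix algebra formed by a complete Weyl system. -/
noncomputable def basis [Nonempty N] [Fintype G] (h : IsWeylSystem c W)
    (hcard : Fintype.card G = Fintype.card N ^ 2) : Module.Basis G ℂ (Matrix N N ℂ) :=
  basisOfLinearIndependentOfCardEqFinrank h.linearIndependent (by
    rw [hcard, Module.finrank_matrix]
    simp [sq])

theorem basis_apply [Nonempty N] [Fintype G] (h : IsWeylSystem c W)
    (hcard : Fintype.card G = Fintype.card N ^ 2) (v : G) : h.basis hcard v = W v := by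
  simp [basis]

/-- A map of groups that preserves the cocycles induces a *-homomorphism of matrix algebras. -/
theorem exists_starAlgHom [Nonempty N] [Fintype G] (h : IsWeylSystem c W)
    (hcard : Fintype.card G = Fintype.card N ^ 2)
    {G' N' : Type*} [AddCommGroup G'] [Fintype N'] [DecidableEq N'] {c' : G' → G' → ℂ}
    {W' : G' → Matrix N' N' ℂ} (h' : IsWeylSystem c' W') (φ : G →+ G')
    (hφ : ∀ v w, c' (φ v) (φ w) = c v w) :
    ∃ Ψ : Matrix N N ℂ →⋆ₐ[ℂ] Matrix N' N' ℂ, ∀ v, Ψ (W v) = W' (φ v) := by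
  let b := h.basis hcard
  have hb : ∀ v, b v = W v := h.basis_apply hcard
  let f : Matrix N N ℂ →ₗ[ℂ] Matrix N' N' ℂ := b.constr ℂ (fun v => W' (φ v))
  have hf : ∀ v, f (W v) = W' (φ v) := fun v => by
    rw [← hb, b.constr_basis]
  have hone : f 1 = 1 := by rw [← h.map_zero, hf, _root_.map_zero, h'.map_zero]
  have hmul : ∀ x y, f (x * y) = f x * f y := by
    have : (LinearMap.mul ℂ _).compr₂ f = (LinearMap.mul ℂ _).compl₁₂ f f := by
      refine b.ext fun v => b.ext fun w => ?_
      simp only [hb, LinearMap.compr₂_apply, LinearMap.mul_apply', LinearMap.compl₁₂_apply, hf,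
        h.mul, h'.mul, map_smul, map_add, hφ]
    exact fun x y => LinearMap.congr_fun₂ this x y
  have hstar : ∀ x, f (star x) = star (f x) := by
    intro x
    rw [← b.sum_repr x]
    simp only [hb, star_sum, star_smul, map_sum, map_smul, hf, Matrix.star_eq_conjTranspose,
      h.conjTranspose, h'.conjTranspose, map_neg]
  exact ⟨{ AlgHom.ofLinearMap f hone hmul with map_star' := hstar }, hf⟩

end IsWeylSystem

/-- Quasi-orthogonality of the images of two *-homomorphisms from a matrix algebra with a complete
Weyl system. -/
theorem IsWeylSystem.quasiOrthogonal_range {G N : Type*} [AddCommGroup G] [Fintype N]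
    [DecidableEq N] {c : G → G → ℂ} {W : G → Matrix N N ℂ} [Nonempty N] [Fintype G]
    (h : IsWeylSystem c W) (hcard : Fintype.card G = Fintype.card N ^ 2)
    {G' : Type*} [AddCommGroup G'] {d : ℕ} [NeZero d] {c' : G' → G' → ℂ}
    {W' : G' → Matrix (Fin d) (Fin d) ℂ} (h' : IsWeylSystem c' W')
    {φ₁ φ₂ : G →+ G'} (hφ : ∀ v w, v ≠ 0 → φ₁ v ≠ φ₂ w) (hφ₁ : ∀ v, v ≠ 0 → φ₁ v ≠ 0)
    {Ψ₁ Ψ₂ : Matrix N N ℂ →⋆ₐ[ℂ] Matrix (Fin d) (Fin d) ℂ} (hΨ₁ : ∀ v, Ψ₁ (W v) = W' (φ₁ v))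
    (hΨ₂ : ∀ v, Ψ₂ (W v) = W' (φ₂ v)) :
    QuasiOrthogonal Ψ₁.range Ψ₂.range := by
  rintro _ ⟨⟨X, rfl⟩, hX⟩ _ ⟨⟨Y, rfl⟩, hY⟩
  have hrepr : ∀ X : Matrix N N ℂ, X = ∑ v, (h.basis hcard).repr X v • W v := fun X => by
    conv_lhs => rw [← (h.basis hcard).sum_repr X]
    simp only [h.basis_apply]
  set a := (h.basis hcard).repr X
  set b := (h.basis hcard).repr Y
  have hX' : Ψ₁ X = ∑ v, a v • W' (φ₁ v) := by
    rw [hrepr X, map_sum]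
    simp only [map_smul, hΨ₁, a]
  have hY' : Ψ₂ Y = ∑ v, b v • W' (φ₂ v) := by
    rw [hrepr Y, map_sum]
    simp only [map_smul, hΨ₂, b]
  -- Every Weyl operator other than the identity is traceless, so the trace of `Ψ₁ X` is a nonzero
  -- multiple of `a 0`.
  have ha : a 0 = 0 := by
    have h1 := hX 1
    simp only [hsInner, one_smul, Matrix.conjTranspose_one, one_mul] at h1
    erw [hX'] at h1
    rw [Matrix.trace_sum, Finset.sum_eq_single 0 (fun v _ hv => by
      rw [Matrix.trace_smul, h'.trace _ (hφ₁ v hv), smul_zero]) (by simp)] at h1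
    simpa [h'.map_zero, NeZero.ne] using h1
  change ((Ψ₁ X)ᴴ * Ψ₂ Y).trace = 0
  rw [hX', hY', Matrix.conjTranspose_sum, Finset.sum_mul_sum, Matrix.trace_sum]
  refine Finset.sum_eq_zero fun v _ => ?_
  rw [Matrix.trace_sum]
  refine Finset.sum_eq_zero fun w _ => ?_
  by_cases hv : v = 0
  · simp [hv, ha]
  · rw [Matrix.conjTranspose_smul, smul_mul_smul_comm, Matrix.trace_smul,
      h'.trace_conjTranspose_mul (hφ v w hv), smul_zero]

variable {F : Type*} [Field F] [Fintype F] [DecidableEq F] {ι : Type*} [Fintype ι]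
  [DecidableEq ι]

/-- The Weyl operator `f ↦ (t ↦ χ(b·t + a·b/2) f(t + a))` up to transposition, for `v = (a, b)`. -/
noncomputable def weylOp (χ : AddChar F ℂ) (v : ι → F × F) : Matrix (ι → F) (ι → F) ℂ :=
  Matrix.of fun s t =>
    if s = t + Prod.fst ∘ v then χ (∑ i, ((v i).2 * t i + (v i).1 * (v i).2 / 2)) else 0

/-- The term `a·b/2` in the phase makes the cocycle a function of the alternating form alone, so
form-preserving maps preserve cocycles. -/
theorem isWeylSystem_weylOp {χ : AddChar F ℂ} (hχ : χ.IsPrimitive) (h2 : (2 : F) ≠ 0) :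
    IsWeylSystem (fun v w => χ (-(sumForm v w / 2))) (weylOp (ι := ι) χ) where
  map_zero := by
    ext s t
    simp [weylOp, Matrix.one_apply, funext_iff]
  mul v w := by
    ext s t
    simp only [weylOp, Matrix.mul_apply, Matrix.of_apply, Matrix.smul_apply, mul_ite, mul_zero,
      Finset.sum_ite_eq', Finset.mem_univ, if_true, ite_mul, zero_mul, smul_eq_mul]
    have he : s = t + Prod.fst ∘ w + Prod.fst ∘ v ↔ s = t + Prod.fst ∘ (v + w) := by
      rw [show t + Prod.fst ∘ (v + w) = t + Prod.fst ∘ w + Prod.fst ∘ v by ext i; simp; ring]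
    simp only [he, ← AddChar.map_add_eq_mul]
    congr 2
    simp only [sumForm, planeForm, Finset.sum_div, ← Finset.sum_neg_distrib,
      ← Finset.sum_add_distrib]
    refine Finset.sum_congr rfl fun i _ => ?_
    simp only [Pi.add_apply, Function.comp_apply, Prod.fst_add, Prod.snd_add]
    field_simp
    ring
  conjTranspose v := by
    ext s t
    simp only [weylOp, Matrix.conjTranspose_apply, Matrix.of_apply]
    have he : t = s + Prod.fst ∘ v ↔ s = t + Prod.fst ∘ (-v) := by
      constructor <;> rintro rfl <;> ext i <;> simp
    by_cases hs : t = s + Prod.fst ∘ v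
    · rw [if_pos hs, if_pos (he.1 hs), Complex.star_def, ← AddChar.map_neg_eq_conj,
        ← Finset.sum_neg_distrib]
      congr 1
      refine Finset.sum_congr rfl fun i _ => ?_
      simp only [hs, Pi.add_apply, Pi.neg_apply, Function.comp_apply, Prod.fst_neg, Prod.snd_neg]
      field_simp
      ring
    · rw [if_neg hs, if_neg (mt he.2 hs), star_zero]
  cocycle_ne_zero v w := (AddChar.val_isUnit χ _).ne_zero
  trace v hv := by
    simp only [weylOp, Matrix.trace, Matrix.diag_apply, Matrix.of_apply]
    -- A nonzero shift leaves the diagonal empty; with no shift, the trace is the sum of a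
    -- nontrivial character.
    by_cases ha : Prod.fst ∘ v = 0
    · simp only [ha, add_zero, if_true]
      have hv1 : ∀ i, (v i).1 = 0 := congrFun ha
      obtain ⟨j, hj⟩ : ∃ j, (v j).2 ≠ 0 := by
        by_contra! h0
        exact hv (funext fun i => Prod.ext (hv1 i) (h0 i))
      let ψ : AddChar (ι → F) ℂ :=
        { toFun := fun t => χ (∑ i, (v i).2 * t i)
          map_zero_eq_one' := by simp
          map_add_eq_mul' := fun s t => by
            simp [mul_add, Finset.sum_add_distrib, AddChar.map_add_eq_mul] }
      have hψ : ψ ≠ 0 := by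
        intro h0
        refine hχ hj ?_
        ext t
        have h1 : ψ (Pi.single j t) = 1 := by rw [h0, AddChar.zero_apply]
        have h3 : ∑ i, (v i).2 * (Pi.single j t : ι → F) i = (v j).2 * t := by
          rw [Finset.sum_eq_single j (fun i _ hi => by simp [hi]) (by simp), Pi.single_eq_same]
        simpa [ψ, h3, AddChar.mulShift_apply] using h1
      simpa [hv1, ψ] using AddChar.sum_eq_zero_iff_ne_zero.2 hψ
    · refine Finset.sum_eq_zero fun t _ => if_neg fun h0 => ha ?_
      exact left_eq_add.1 h0

end WeylSystems

/-! ### Assembly -/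

/-- Over a finite field of odd order, hyperbolic planes that meet pairwise trivially give
quasi-orthogonal subalgebras. -/
theorem containsQuasiOrthogonal_of_field (F : Type) [Field F] [Fintype F]
    (hF : ringChar F ≠ 2) (n : ℕ) :
    ContainsQuasiOrthogonal (Fintype.card F ^ n) (Fintype.card F)
      (∑ i ∈ Finset.range n, (Fintype.card F ^ 2) ^ i) := by
  classical
  have h2 : (2 : F) ≠ 0 := Ring.two_ne_zero hF
  obtain ⟨d, hd⟩ := FiniteField.exists_nonsquare hF
  obtain ⟨h, hform, hdisj⟩ := exists_hyperbolic_planes hd h2 n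
  have hχ := AddChar.FiniteField.primitiveChar_to_Complex_isPrimitive F
  set χ := AddChar.FiniteField.primitiveChar_to_Complex F
  have : NeZero (Fintype.card F) := ⟨Fintype.card_ne_zero⟩
  have h1 := (isWeylSystem_weylOp (ι := Fin 1) hχ h2).reindex
    (Fintype.equivFinOfCardEq (n := Fintype.card F) (by simp))
  have hn := (isWeylSystem_weylOp (ι := Fin n) hχ h2).reindex
    (Fintype.equivFinOfCardEq (n := Fintype.card F ^ n) (by simp))
  have hcard : Fintype.card (Fin 1 → F × F) = Fintype.card (Fin (Fintype.card F)) ^ 2 := by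
    simp [sq]
  let φ : ∀ i, (Fin 1 → F × F) →+ (Fin n → F × F) := fun i =>
    (h i).comp (Pi.evalAddMonoidHom _ 0)
  have hφ : ∀ i v w, sumForm (φ i v) (φ i w) = sumForm v w := fun i v w => by
    rw [AddMonoidHom.comp_apply, AddMonoidHom.comp_apply, hform]
    simp [sumForm]
  choose Ψ hΨ using fun i => h1.exists_starAlgHom hcard hn (φ i) (fun v w => by rw [hφ])
  have hv0 : ∀ v : Fin 1 → F × F, v ≠ 0 → v 0 ≠ 0 := fun v hv h0 =>
    hv (funext fun i => by rw [Subsingleton.elim i 0, h0, Pi.zero_apply])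
  refine ⟨fun i => (Ψ i).range, fun i => ⟨(StarAlgEquiv.ofInjective (Ψ i) ?_).symm⟩,
    fun i j hij => h1.quasiOrthogonal_range hcard hn (φ₁ := φ i) (φ₂ := φ j)
      (fun v w hv hvw => hij (hdisj i j _ _ (hv0 v hv) hvw)) (fun v hv h0 => ?_) (hΨ i) (hΨ j)⟩
  -- Full matrix algebras are simple.
  · exact RingHom.injective (Ψ i).toAlgHom.toRingHom
  · obtain ⟨z, hz⟩ := exists_planeForm_ne_zero (hv0 v hv)
    rw [← hform i, show h i (v 0) = 0 from h0] at hz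
    simp [sumForm, planeForm] at hz

theorem mainTheorem1 (p k n : ℕ) (hp : p.Prime) (hp_odd : Odd p) (hk : 1 ≤ k) (hn : 1 ≤ n) :
    IsGreatest {l : ℕ | ContainsQuasiOrthogonal (p ^ (k * n)) (p ^ k) l}
      (quasiOrthNumber p k n) := by
  have hq : 2 ≤ p ^ (2 * k) := hp.two_le.trans (Nat.le_self_pow (by omega) p)
  constructor
  · have := Fact.mk hp
    have : Fintype (GaloisField p k) := Fintype.ofFinite _
    have hcard : Fintype.card (GaloisField p k) = p ^ k := by
      rw [← Nat.card_eq_fintype_card, GaloisField.card p k (by omega)]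
    have hF : ringChar (GaloisField p k) ≠ 2 := by
      rw [ringChar.eq (GaloisField p k) p]
      rintro rfl
      exact absurd hp_odd (by decide)
    have h := containsQuasiOrthogonal_of_field (GaloisField p k) hF n
    rw [hcard, ← pow_mul, ← pow_mul, mul_comm k 2, Nat.geomSum_eq hq, ← pow_mul] at h
    exact h
  · intro l hl
    have h := ContainsQuasiOrthogonal.mul_le (m := p ^ k) (l := l) (pow_ne_zero _ hp.ne_zero) hl
    rw [← pow_mul, ← pow_mul, mul_comm k 2, mul_comm (k * n) 2, ← mul_assoc,
      ← quasiOrthNumber_mul] at h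
    exact Nat.le_of_mul_le_mul_right h (by omega)
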